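/- Let $n\ge 1$ and let $\mu$ be a nonzero finite Borel measure on $\mathbb{R}^n$ which is even ($\mu(-A)=\mu(A)$ for every Borel set $A$), is not concentrated on any proper linear subspace ($\mu(\mathbb{R}^n\setminus H)>0$ for every linear subspace $H$ with $\dim H<n$), and has finite first moment, $\int_{\mathbb{R}^n}|x|\,d\mu(x)<\infty$. Let $\mathcal{L}$ be the set of convex, lower semi-continuous functions $\varphi:\mathbb{R}^n\to\mathbb{R}\cup\{+\infty\}$, not identically $+\infty$, such that $\liminf_{|x|\to\infty}\varphi(x)/|x|>0$. For $\varphi\in\mathcal{L}$ let $\mu_{\gamma_n}(\varphi,\cdot)$ be the push-forward under $\nabla\varphi$ of the measure $c_{n+1}e^{-\varphi(x)^2/2}e^{-|x|^2/2}\,dx$, where $c_{n+1}=(2\pi)^{-\frac{n+1}{2}}$ and $e^{-\varphi(x)^2/2}=0$ where $\varphi(x)=+\infty$; here $\nabla\varphi$ is defined almost everywhere with respect to that measure. Then there exists $\varphi\in\mathcal{L}$ such that $0<\mu_{\gamma_n}(\varphi,\mathbb{R}^n)<\infty$ and $$\mu=\frac{\mu(\mathbb{R}^n)}{\mu_{\gamma_n}(\varphi,\mathbb{R}^n)}\;\mu_{\gamma_n}(\varphi,\cdot).$$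 -/

import Mathlib

open MeasureTheory Set Filter

noncomputable section

namespace GaussianMinkowski

/-- Proper, lower semi-continuous, convex functions `φ : ℝⁿ → ℝ ∪ {+∞}`. The values lie in
`EReal`, with `⊥` excluded; the product in `EReal` has the convention `0 * ⊤ = 0`. -/
structure IsConvFun {n : ℕ} (φ : EuclideanSpace ℝ (Fin n) → EReal) : Prop where
  ne_bot : ∀ x, φ x ≠ ⊥
  proper : ∃ x, φ x < ⊤
  lsc : LowerSemicontinuous φ
  convex : ∀ x y : EuclideanSpace ℝ (Fin n), ∀ t : ℝ, 0 ≤ t → t ≤ 1 →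
    φ ((1 - t) • x + t • y) ≤ ((1 - t : ℝ) : EReal) * φ x + (t : EReal) * φ y

/-- The class `𝓛`: functions as above with `liminf_{|x| → ∞} φ(x) / |x| > 0`. -/
structure MemL {n : ℕ} (φ : EuclideanSpace ℝ (Fin n) → EReal) : Prop extends IsConvFun φ where
  growth : 0 < liminf (fun x => φ x / ((‖x‖ : ℝ) : EReal))
    (Bornology.cobounded (EuclideanSpace ℝ (Fin n)))

/-- The density `c_{n+1} e^{-φ(x)²/2} e^{-|x|²/2}` with `c_{n+1} = (2π)^{-(n+1)/2}`;
it is `0` where `φ = +∞`. -/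
def momentDensity {n : ℕ} (φ : EuclideanSpace ℝ (Fin n) → EReal) :
    EuclideanSpace ℝ (Fin n) → ENNReal :=
  {x | φ x < ⊤}.indicator fun x => ENNReal.ofReal
    ((2 * Real.pi) ^ (-((n : ℝ) + 1) / 2) *
      Real.exp (-(φ x).toReal ^ 2 / 2) * Real.exp (-‖x‖ ^ 2 / 2))

/-- The Euclidean Gaussian moment measure of `φ`: the push-forward of
`c_{n+1} e^{-φ(x)²/2} e^{-|x|²/2} dx` under `∇φ`. In the interior of the effective domain the
function `fun y => (φ y).toReal` is `φ`, so its gradient is `∇φ` wherever `φ` is differentiable;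
for a convex `φ` all other points form a null set of the measure that is pushed forward. -/
def gaussianMomentMeasure {n : ℕ} (φ : EuclideanSpace ℝ (Fin n) → EReal) :
    Measure (EuclideanSpace ℝ (Fin n)) :=
  (volume.withDensity (momentDensity φ)).map (gradient fun y => (φ y).toReal)

end GaussianMinkowski

end

/-!
The measure is obtained from a maximiser of a dual variational problem. Among even functions `f`
with `∫ f dμ ≤ 0` (`Admissible`), maximise the Gaussian volume of the epigraph of the Legendre
conjugate `conj f`, that is `∫ Ψ(conj f x) e^{-|x|²/2} dx` with `Ψ` the Gaussian tail (`epiVolume`).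
Since `-Ψ'(a) = e^{-a²/2}` and the derivative of `(f + t k)*` at `t = 0` is `-k ∘ ∇f*`
(`hasDerivAt_toReal_conj_add`), the first variation in a direction `k` with `∫ k dμ = 0` is
`∫ k(∇φ) e^{-φ²/2} e^{-|x|²/2} dx` for `φ = conj f`. At a maximiser it vanishes for all bounded
continuous even `k` of mean zero (`integral_firstVariation_eq_zero`). As `μ` and the moment measure
of `φ` are both even, odd test functions integrate to `0` against both, so the two measures are
proportional.

A maximiser exists by compactness (`exists_isMaxOn_epiVolume`). Along a maximising sequence the
epigraphs have Gaussian volume bounded below, so some sublevel sets of the even convex functions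
`conj (f k)` have large volume, contain a common ball, and the functions are bounded above on it
(`exists_ball_conj_le`). This gives a subsequence converging almost everywhere
(`exists_subseq_ae_tendsto`); the conjugate of its upper limit is admissible by Fatou's lemma
(`admissible_conj_limsup`) and maximal by dominated convergence.

The growth condition holds for every admissible `f`: evenness gives `|⟪x, y⟫| ≤ conj f x + f y`, and
integration in `y` yields `μ(E) conj f x ≥ ∫ |⟪x, y⟫| dμ(y)` (`integral_abs_inner_le`), which is at
least `c |x|` because `μ` is not concentrated on a hyperplane
(`exists_mul_norm_le_integral_abs_inner`).
-/

noncomputable section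

namespace GaussianMinkowski

open Topology

/-! ### The one-dimensional Gaussian tail -/

/-- The unnormalised Gaussian tail `∫_{s > a} e^{-s²/2} ds` at an extended real `a`; it vanishes at
`a = ⊤`. -/
def gaussTail (a : EReal) : ℝ :=
  ∫ s in {s : ℝ | a < s}, Real.exp (-s ^ 2 / 2)

lemma integrable_exp_neg_sq_div_two : Integrable fun s : ℝ => Real.exp (-s ^ 2 / 2) := by
  have := integrable_exp_neg_mul_sq (b := 1 / 2) (by norm_num)
  refine this.congr (Eventually.of_forall fun s => ?_)
  simp only
  congr 1
  ring

lemma gaussTail_top : gaussTail ⊤ = 0 := by simp [gaussTail]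

lemma gaussTail_nonneg (a : EReal) : 0 ≤ gaussTail a :=
  integral_nonneg fun _ => (Real.exp_pos _).le

lemma gaussTail_antitone : Antitone gaussTail := by
  intro a b hab
  refine setIntegral_mono_set integrable_exp_neg_sq_div_two.integrableOn
    (Eventually.of_forall fun _ => (Real.exp_pos _).le) (LE.le.eventuallyLE ?_)
  intro s hs
  exact lt_of_le_of_lt hab hs

lemma gaussTail_coe (r : ℝ) : gaussTail r = ∫ s in Ioi r, Real.exp (-s ^ 2 / 2) := by
  simp only [gaussTail, EReal.coe_lt_coe_iff]
  rfl

lemma gaussTail_coe_eq (r : ℝ) :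
    gaussTail r = gaussTail (0 : ℝ) - ∫ s in (0 : ℝ)..r, Real.exp (-s ^ 2 / 2) := by
  rw [gaussTail_coe, gaussTail_coe,
    ← intervalIntegral.integral_Ioi_sub_Ioi' integrable_exp_neg_sq_div_two.integrableOn
      integrable_exp_neg_sq_div_two.integrableOn]
  ring

lemma hasDerivAt_gaussTail (r : ℝ) :
    HasDerivAt (fun r : ℝ => gaussTail r) (-Real.exp (-r ^ 2 / 2)) r := by
  have hc : Continuous fun s : ℝ => Real.exp (-s ^ 2 / 2) := by fun_prop
  have := (intervalIntegral.integral_hasDerivAt_right (hc.intervalIntegrable 0 r)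
    hc.stronglyMeasurable.stronglyMeasurableAtFilter hc.continuousAt).const_sub
      (gaussTail (0 : ℝ))
  exact this.congr_of_eventuallyEq (Eventually.of_forall gaussTail_coe_eq)

lemma continuous_gaussTail_coe : Continuous fun r : ℝ => gaussTail r :=
  continuous_iff_continuousAt.2 fun r => (hasDerivAt_gaussTail r).continuousAt

lemma abs_gaussTail_sub_le (a b : ℝ) : |gaussTail a - gaussTail b| ≤ |a - b| := by
  have := Convex.norm_image_sub_le_of_norm_hasDerivWithin_le (C := 1) (s := univ)
    (f := fun r : ℝ => gaussTail r) (f' := fun r => -Real.exp (-r ^ 2 / 2))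
    (fun x _ => (hasDerivAt_gaussTail x).hasDerivWithinAt)
    (fun x _ => by
      rw [norm_neg, Real.norm_eq_abs, abs_of_pos (Real.exp_pos _), Real.exp_le_one_iff]
      nlinarith [sq_nonneg x])
    convex_univ (mem_univ b) (mem_univ a)
  simpa using this

lemma gaussTail_pos (r : ℝ) : 0 < gaussTail r := by
  rw [gaussTail_coe]
  refine (setIntegral_pos_iff_support_of_nonneg_ae
    (Eventually.of_forall fun _ => (Real.exp_pos _).le)
    integrable_exp_neg_sq_div_two.integrableOn).2 ?_
  have : Function.support (fun s : ℝ => Real.exp (-s ^ 2 / 2)) = univ := by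
    ext s; simp [(Real.exp_pos _).ne']
  simp [this]

lemma tendsto_gaussTail_atTop : Tendsto (fun r : ℝ => gaussTail r) atTop (𝓝 0) := by
  have h := intervalIntegral_tendsto_integral_Ioi (0 : ℝ)
    (integrable_exp_neg_sq_div_two.integrableOn) tendsto_id
  have := h.const_sub (gaussTail (0 : ℝ))
  rw [← gaussTail_coe, sub_self] at this
  exact this.congr fun r => (gaussTail_coe_eq r).symm

lemma continuousAt_gaussTail {a : EReal} (ha : a ≠ ⊥) : ContinuousAt gaussTail a := by
  induction a with
  | bot => exact absurd rfl ha
  | coe r =>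
    have : Tendsto gaussTail (𝓝 (r : EReal)) (𝓝 (gaussTail r)) := by
      rw [EReal.nhds_coe, tendsto_map'_iff]
      exact continuous_gaussTail_coe.continuousAt
    exact this
  | top =>
    rw [ContinuousAt, gaussTail_top, Metric.tendsto_nhds]
    intro ε hε
    obtain ⟨r, hr⟩ := (tendsto_gaussTail_atTop.eventually (gt_mem_nhds hε)).exists
    filter_upwards [lt_mem_nhds (EReal.coe_lt_top r)] with b hb
    rw [Real.dist_eq, sub_zero, abs_of_nonneg (gaussTail_nonneg _)]
    exact (gaussTail_antitone hb.le).trans_lt hr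

lemma measurable_gaussTail : Measurable gaussTail := gaussTail_antitone.measurable

/-! ### Legendre conjugates of extended real valued functions -/

lemma ereal_le_of_forall_coe {a b : EReal} (h : ∀ r : ℝ, b ≤ r → a ≤ r) : a ≤ b := by
  induction b with
  | bot =>
    refine le_of_forall_gt fun c hc => ?_
    obtain ⟨r, _, hr⟩ := EReal.lt_iff_exists_real_btwn.1 hc
    exact (h r bot_le).trans_lt hr
  | coe r => exact h r le_rfl
  | top => exact le_top

lemma coe_sub_le_coe_iff {a r : ℝ} {b : EReal} :
    (a : EReal) - b ≤ r ↔ ((a - r : ℝ) : EReal) ≤ b := by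
  induction b with
  | bot => simp [-EReal.coe_sub]
  | coe b => norm_cast; constructor <;> intro <;> linarith
  | top => simp

lemma coe_le_add_coe_iff {a c : ℝ} {b : EReal} :
    (a : EReal) ≤ b + c ↔ ((a - c : ℝ) : EReal) ≤ b := by
  induction b with
  | bot => simp [-EReal.coe_sub]
  | coe b => norm_cast; constructor <;> intro <;> linarith
  | top => simp

section

variable {E : Type*} [NormedAddCommGroup E] [InnerProductSpace ℝ E]

/-- The Legendre conjugate `sup_y (⟪x, y⟫ - f y)`. -/
def conj (f : E → EReal) (x : E) : EReal := ⨆ y, ((inner ℝ x y : ℝ) : EReal) - f y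

lemma conj_le_coe {f : E → EReal} {x : E} {r : ℝ} :
    conj f x ≤ r ↔ ∀ y, ((inner ℝ x y - r : ℝ) : EReal) ≤ f y := by
  simp only [conj, iSup_le_iff, coe_sub_le_coe_iff]

lemma inner_sub_le_conj (f : E → EReal) (x y : E) :
    ((inner ℝ x y : ℝ) : EReal) - f y ≤ conj f x :=
  le_iSup (fun y => ((inner ℝ x y : ℝ) : EReal) - f y) y

lemma conj_conj_le (f : E → EReal) (x : E) : conj (conj f) x ≤ f x := by
  refine ereal_le_of_forall_coe fun r hr => conj_le_coe.2 fun y => ?_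
  refine le_trans ?_ (inner_sub_le_conj f y x)
  rw [real_inner_comm, EReal.coe_sub]
  exact EReal.sub_le_sub le_rfl hr

lemma conj_even {f : E → EReal} (hf : ∀ y, f (-y) = f y) (x : E) : conj f (-x) = conj f x := by
  unfold conj
  rw [← (Equiv.neg E).iSup_comp]
  simp [hf]

lemma lowerSemicontinuous_conj (f : E → EReal) : LowerSemicontinuous (conj f) := by
  have : conj f = fun x => ⨆ y, ((inner ℝ x y : ℝ) : EReal) - f y := rfl
  rw [this]
  refine lowerSemicontinuous_iSup fun y => Continuous.lowerSemicontinuous ?_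
  rcases eq_or_ne (f y) ⊥ with h | h
  · simpa [h] using continuous_const
  rcases eq_or_ne (f y) ⊤ with h' | h'
  · simpa [h'] using continuous_const
  lift f y to ℝ using ⟨h', h⟩ with c
  simp only [← EReal.coe_sub]
  exact continuous_coe_real_ereal.comp (by fun_prop)

lemma conj_convex {f : E → EReal} {x y : E} {a b t : ℝ} (h0 : 0 ≤ t) (h1 : t ≤ 1)
    (hx : conj f x ≤ a) (hy : conj f y ≤ b) :
    conj f ((1 - t) • x + t • y) ≤ ((1 - t) * a + t * b : ℝ) := by
  rw [conj_le_coe] at *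
  intro z
  specialize hx z
  specialize hy z
  refine le_trans ?_ (max_le hx hy)
  rw [← EReal.coe_strictMono.monotone.map_max, EReal.coe_le_coe_iff, inner_add_left,
    real_inner_smul_left, real_inner_smul_left]
  have h2 := le_max_left (inner ℝ x z - a) (inner ℝ y z - b)
  have h3 := le_max_right (inner ℝ x z - a) (inner ℝ y z - b)
  nlinarith

lemma convex_conj_le (f : E → EReal) (C : ℝ) : Convex ℝ {x | conj f x ≤ C} := by
  intro x hx y hy a b ha hb hab
  obtain rfl : a = 1 - b := by linarith
  have := conj_convex hb (by linarith) hx hy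
  rwa [show (1 - b) * C + b * C = C by ring] at this

lemma conj_ne_bot {f : E → EReal} (hf : ∃ y, f y ≠ ⊤) (x : E) : conj f x ≠ ⊥ := by
  obtain ⟨y, hy⟩ := hf
  intro h
  have := inner_sub_le_conj f x y
  rw [h, le_bot_iff] at this
  induction hfy : f y with
  | bot => simp [hfy] at this
  | coe c => rw [hfy, ← EReal.coe_sub] at this; exact EReal.coe_ne_bot _ this
  | top => exact hy hfy

lemma isConvFun_conj {n : ℕ} {f : EuclideanSpace ℝ (Fin n) → EReal} (hf : ∃ y, f y ≠ ⊤)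
    (hp : ∃ x, conj f x < ⊤) : IsConvFun (conj f) where
  ne_bot := conj_ne_bot hf
  proper := hp
  lsc := lowerSemicontinuous_conj f
  convex x y t h0 h1 := by
    rcases h0.eq_or_lt with rfl | h0'
    · simp
    rcases h1.eq_or_lt with rfl | h1'
    · simp
    have hx := conj_ne_bot hf x
    have hy := conj_ne_bot hf y
    induction hcx : conj f x with
    | bot => exact absurd hcx hx
    | coe a =>
      induction hcy : conj f y with
      | bot => exact absurd hcy hy
      | coe b =>
        have := conj_convex h0 h1 hcx.le hcy.le
        rwa [EReal.coe_add, EReal.coe_mul, EReal.coe_mul] at this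
      | top =>
        rw [EReal.coe_mul_top_of_pos h0', ← EReal.coe_mul, EReal.coe_add_top]
        exact le_top
    | top =>
      rw [EReal.coe_mul_top_of_pos (by linarith : 0 < 1 - t), EReal.top_add_of_ne_bot]
      · exact le_top
      · induction hcy : conj f y with
        | bot => exact absurd hcy hy
        | coe b => rw [← EReal.coe_mul]; exact EReal.coe_ne_bot _
        | top => rw [EReal.coe_mul_top_of_pos h0']; simp

/-- Perturbing `f` by a function bounded by `δ` moves its conjugate by at most `δ`. -/
lemma conj_add_le {f : E → EReal} {k l : E → ℝ} {δ : ℝ} (hkl : ∀ y, k y ≤ l y + δ) {x : E} {r : ℝ}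
    (h : conj (fun y => f y + k y) x ≤ r) : conj (fun y => f y + l y) x ≤ (r + δ : ℝ) := by
  rw [conj_le_coe] at *
  intro y
  have := h y
  rw [coe_le_add_coe_iff] at *
  refine le_trans (EReal.coe_le_coe_iff.2 ?_) this
  linarith [hkl y]

end

/-! ### The admissible class and its coercivity -/

section

variable {E : Type*} [NormedAddCommGroup E] [InnerProductSpace ℝ E]

/-- The constraint of the variational problem: `f` is even and `∫ f dμ ≤ 0`, the latter expressed
through a real valued integrable majorant because `f` may take the value `⊤` on a null set. -/
structure Admissible [MeasurableSpace E] (μ : Measure E) (f : E → EReal) : Prop where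
  even : ∀ y, f (-y) = f y
  majorant : ∃ F : E → ℝ, Integrable F μ ∧ ∫ y, F y ∂μ ≤ 0 ∧ ∀ᵐ y ∂μ, f y ≤ F y

lemma Admissible.exists_ne_top {E : Type*} [NormedAddCommGroup E] [MeasurableSpace E]
    {μ : Measure E} [NeZero μ] {f : E → EReal}
    (hf : Admissible μ f) : ∃ y, f y ≠ ⊤ := by
  obtain ⟨F, -, -, h⟩ := hf.majorant
  obtain ⟨y, hy⟩ := h.exists
  exact ⟨y, (hy.trans_lt (EReal.coe_lt_top _)).ne⟩

lemma inner_le_of_conj_le {f : E → EReal} {x y : E} {r c : ℝ} (h : conj f x ≤ r) (hc : f y ≤ c) :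
    inner ℝ x y ≤ r + c := by
  have := (conj_le_coe.1 h y).trans hc
  rw [EReal.coe_le_coe_iff] at this
  linarith

/-- As `f` is even, `|⟪x, y⟫| ≤ conj f x + f y`; integrating in `y` removes `f`. -/
lemma integral_abs_inner_le [MeasurableSpace E] [OpensMeasurableSpace E] [SecondCountableTopology E]
    {μ : Measure E} [IsFiniteMeasure μ]
    (hmom : Integrable (fun x : E => ‖x‖) μ) {f : E → EReal} (hf : Admissible μ f) {x : E} {r : ℝ}
    (h : conj f x ≤ r) : ∫ y, |inner ℝ x y| ∂μ ≤ r * μ.real univ := by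
  obtain ⟨F, hF, hF0, hfF⟩ := hf.majorant
  have hint : Integrable (fun y => |inner ℝ x y|) μ := by
    refine (hmom.const_mul ‖x‖).mono' (by fun_prop) (Eventually.of_forall fun y => ?_)
    simpa using abs_real_inner_le_norm x y
  have h' : conj f (-x) ≤ r := by rwa [conj_even hf.even]
  calc ∫ y, |inner ℝ x y| ∂μ ≤ ∫ y, (r + F y) ∂μ := by
        refine integral_mono_ae hint ((integrable_const _).add hF) ?_
        filter_upwards [hfF] with y hy
        refine abs_le.2 ⟨?_, inner_le_of_conj_le h hy⟩
        have := inner_le_of_conj_le h' hy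
        rw [inner_neg_left] at this
        linarith
    _ = r * μ.real univ + ∫ y, F y ∂μ := by
        rw [integral_add (integrable_const _) hF]
        simp [mul_comm]
    _ ≤ r * μ.real univ := by linarith

/-- A finite measure with finite first moment that charges the complement of every hyperplane
has `∫ |⟪x, y⟫| dμ(y) ≥ c ‖x‖`. -/
lemma exists_mul_norm_le_integral_abs_inner [MeasurableSpace E] [BorelSpace E]
    [FiniteDimensional ℝ E] {μ : Measure E}
    (hmom : Integrable (fun x : E => ‖x‖) μ)
    (hconc : ∀ H : Submodule ℝ E, Module.finrank ℝ H < Module.finrank ℝ E →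
      μ ((H : Set E)ᶜ) ≠ 0) :
    ∃ c : ℝ, 0 < c ∧ ∀ x : E, c * ‖x‖ ≤ ∫ y, |inner ℝ x y| ∂μ := by
  have hint : ∀ x : E, Integrable (fun y => |inner ℝ x y|) μ := fun x => by
    refine (hmom.const_mul ‖x‖).mono' (by fun_prop) (Eventually.of_forall fun y => ?_)
    simpa using abs_real_inner_le_norm x y
  set N : E → ℝ := fun x => ∫ y, |inner ℝ x y| ∂μ with hN
  have hpos : ∀ x : E, x ≠ 0 → 0 < N x := by
    intro x hx
    refine lt_of_le_of_ne (integral_nonneg fun _ => abs_nonneg _) fun h0 => ?_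
    have h1 := (integral_eq_zero_iff_of_nonneg (fun _ => abs_nonneg _) (hint x)).1 h0.symm
    refine hconc (ℝ ∙ x)ᗮ ?_ ?_
    · have := Submodule.finrank_add_finrank_orthogonal (ℝ ∙ x)
      rw [finrank_span_singleton hx] at this
      omega
    · refine measure_mono_null (fun y hy => ?_) (ae_iff.1 h1)
      simpa [Submodule.mem_orthogonal_singleton_iff_inner_right] using hy
  have hcont : Continuous N := by
    refine continuous_iff_continuousAt.2 fun x₀ => ?_
    refine continuousAt_of_dominated (bound := fun y => (‖x₀‖ + 1) * ‖y‖)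
      (Eventually.of_forall fun x => (hint x).aestronglyMeasurable) ?_ (hmom.const_mul _)
      (Eventually.of_forall fun y => by fun_prop)
    filter_upwards [Metric.ball_mem_nhds x₀ one_pos] with x hx
    refine Eventually.of_forall fun y => ?_
    rw [Real.norm_eq_abs, abs_abs]
    refine (abs_real_inner_le_norm x y).trans (mul_le_mul_of_nonneg_right ?_ (norm_nonneg _))
    have := norm_sub_norm_le x x₀
    rw [Metric.mem_ball, dist_eq_norm] at hx
    linarith
  rcases subsingleton_or_nontrivial E with hE | hE
  · exact ⟨1, one_pos, fun x => by simp [Subsingleton.elim x 0]⟩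
  obtain ⟨x₀, hx₀, hmin⟩ := (isCompact_sphere (0 : E) 1).exists_isMinOn
    (NormedSpace.sphere_nonempty.2 zero_le_one) hcont.continuousOn
  refine ⟨N x₀, hpos x₀ (by rintro rfl; simp at hx₀), fun x => ?_⟩
  rcases eq_or_ne x 0 with rfl | hx
  · simp
  have h1 : N x₀ ≤ N (‖x‖⁻¹ • x) := by
    apply hmin
    simp [norm_smul, inv_mul_cancel₀ (norm_ne_zero_iff.2 hx)]
  have h2 : N (‖x‖⁻¹ • x) = ‖x‖⁻¹ * N x := by
    simp only [hN, real_inner_smul_left, abs_mul, integral_const_mul]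
    simp
  rw [h2, inv_mul_eq_div, le_div_iff₀ (norm_pos_iff.2 hx)] at h1
  exact h1

/-! ### Symmetric convex sets of large volume contain a ball -/

variable [MeasurableSpace E] [BorelSpace E] [FiniteDimensional ℝ E]

/-- If `v ∉ K`, the translates of `K ∩ B_R` by the multiples of `2v` are disjoint. When `v` is
short, `N` of them fit into a fixed ball, which bounds `N`. -/
lemma exists_ball_subset_of_symmetric_convex {R : ℝ} {δ : ENNReal} (hδ : 0 < δ) :
    ∃ r : ℝ, 0 < r ∧ ∀ K : Set E, MeasurableSet K → Convex ℝ K → (∀ x ∈ K, -x ∈ K) →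
      δ ≤ volume (K ∩ Metric.closedBall 0 R) → Metric.ball 0 r ⊆ K := by
  obtain ⟨N, hN⟩ : ∃ N : ℕ, volume (Metric.closedBall (0 : E) (R + 2)) < N * δ := by
    rcases eq_or_ne δ ⊤ with rfl | hδt
    · refine ⟨1, ?_⟩
      simpa using measure_closedBall_lt_top
    obtain ⟨N, hN⟩ := ENNReal.exists_nat_gt (ENNReal.div_lt_top
      (measure_closedBall_lt_top (μ := volume) (x := (0 : E)) (r := R + 2)).ne hδ.ne').ne
    exact ⟨N, (ENNReal.div_lt_iff (Or.inl hδ.ne') (Or.inl hδt)).1 hN⟩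
  refine ⟨1 / (N + 1), by positivity, fun K hKm hK hsymm hvol v hv => ?_⟩
  rw [mem_ball_zero_iff] at hv
  have hv1 : (N + 1) * ‖v‖ < 1 := by
    rwa [lt_div_iff₀ (by positivity), mul_comm] at hv
  set A := K ∩ Metric.closedBall 0 R with hA
  have hAm : MeasurableSet A := hKm.inter Metric.isClosed_closedBall.measurableSet
  let T : ℕ → Set E := fun j => (fun x => (-((2 * j : ℝ) • v)) + x) ⁻¹' A
  have hTm : ∀ j, MeasurableSet (T j) := fun j => hAm.preimage (by fun_prop)
  have hsub : ∀ j ∈ Finset.range N, T j ⊆ Metric.closedBall 0 (R + 2) := by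
    intro j hj x hx
    have hx2 := hx.2
    rw [mem_closedBall_zero_iff] at hx2 ⊢
    have hjN : (j : ℝ) ≤ N := by exact_mod_cast (Finset.mem_range.1 hj).le
    have h3 : ‖(2 * j : ℝ) • v‖ ≤ 2 := by
      rw [norm_smul, Real.norm_of_nonneg (by positivity)]
      nlinarith [norm_nonneg v]
    calc ‖x‖ = ‖(-((2 * j : ℝ) • v) + x) + (2 * j : ℝ) • v‖ := by congr 1; abel
      _ ≤ _ := (norm_add_le _ _).trans (by linarith)
  obtain ⟨i, -, j, -, hij, x, hxi, hxj⟩ := exists_nonempty_inter_of_measure_univ_lt_sum_measure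
    (volume.restrict (Metric.closedBall (0 : E) (R + 2))) (s := Finset.range N) (t := T)
    (fun j _ => (hTm j).nullMeasurableSet) (by
      rw [Measure.restrict_apply_univ]
      refine hN.trans_le ?_
      calc (N : ENNReal) * δ = ∑ j ∈ Finset.range N, δ := by simp
        _ ≤ _ := Finset.sum_le_sum fun j hj => by
          rw [Measure.restrict_apply (hTm j), inter_eq_left.2 (hsub j hj),
            measure_preimage_add]
          exact hvol)
  wlog hlt : i < j generalizing i j
  · exact this j i hij.symm hxj hxi (lt_of_le_of_ne (not_lt.1 hlt) hij.symm)
  have hmem : ((j : ℝ) - i) • v ∈ K := by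
    have := hK hxi.1 (hsymm _ hxj.1) (a := 1 / 2) (b := 1 / 2) (by norm_num) (by norm_num)
      (by norm_num)
    convert this using 1
    module
  have h0 : (0 : E) ∈ K := by
    have := hK hmem (hsymm _ hmem) (a := 1 / 2) (b := 1 / 2) (by norm_num) (by norm_num)
      (by norm_num)
    convert this using 1
    module
  have hji : (1 : ℝ) ≤ j - i := by
    have : (i : ℝ) + 1 ≤ j := by exact_mod_cast hlt
    linarith
  have := hK hmem h0 (a := 1 / ((j : ℝ) - i)) (b := 1 - 1 / ((j : ℝ) - i)) (by positivity)
    (by rw [sub_nonneg, div_le_one (by linarith)]; exact hji) (by ring)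
  rwa [smul_zero, add_zero, smul_smul, one_div_mul_cancel (by linarith), one_smul] at this

end

/-! ### The Gaussian volume of an epigraph -/

section

variable {E : Type*} [NormedAddCommGroup E] [InnerProductSpace ℝ E]
  [MeasurableSpace E] [BorelSpace E] [FiniteDimensional ℝ E]

lemma integrable_exp_neg_norm_sq_div {b : ℝ} (hb : 0 < b) :
    Integrable fun x : E => Real.exp (-‖x‖ ^ 2 / b) := by
  have := (GaussianFourier.integrable_cexp_neg_mul_sq_norm_add (V := E) (b := (1 / b : ℝ))
    (by simpa using hb) 0 0).re
  refine this.congr (Eventually.of_forall fun x => ?_)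
  simp only [zero_mul, add_zero]
  rw [show (-((1 / b : ℝ) : ℂ) * (‖x‖ : ℂ) ^ 2) = ((-‖x‖ ^ 2 / b : ℝ) : ℂ) by push_cast; ring]
  exact Complex.exp_ofReal_re _

/-- Up to a constant, the standard Gaussian measure in `E × ℝ` of the epigraph of `φ`. -/
def epiVolume (φ : E → EReal) : ℝ :=
  ∫ x, gaussTail (φ x) * Real.exp (-‖x‖ ^ 2 / 2)

lemma gaussTail_mul_le {E : Type*} [NormedAddCommGroup E] (a : EReal) (x : E) :
    ‖gaussTail a * Real.exp (-‖x‖ ^ 2 / 2)‖ ≤ gaussTail ⊥ * Real.exp (-‖x‖ ^ 2 / 2) := by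
  rw [Real.norm_of_nonneg (mul_nonneg (gaussTail_nonneg _) (Real.exp_pos _).le)]
  exact mul_le_mul_of_nonneg_right (gaussTail_antitone bot_le) (Real.exp_pos _).le

lemma integrable_gaussTail_mul {φ : E → EReal} (hφ : Measurable φ) :
    Integrable fun x => gaussTail (φ x) * Real.exp (-‖x‖ ^ 2 / 2) := by
  refine ((integrable_exp_neg_norm_sq_div two_pos).const_mul (gaussTail ⊥)).mono' ?_
    (Eventually.of_forall fun x => gaussTail_mul_le _ _)
  exact ((measurable_gaussTail.comp hφ).mul (by fun_prop)).aestronglyMeasurable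

lemma measurable_conj {E : Type*} [NormedAddCommGroup E] [InnerProductSpace ℝ E]
    [MeasurableSpace E] [BorelSpace E] (f : E → EReal) : Measurable (conj f) :=
  (lowerSemicontinuous_conj f).measurable

lemma epiVolume_le_of_le {φ ψ : E → EReal} (hφ : Measurable φ) (hψ : Measurable ψ)
    (h : ∀ x, φ x ≤ ψ x) : epiVolume ψ ≤ epiVolume φ :=
  integral_mono (integrable_gaussTail_mul hψ) (integrable_gaussTail_mul hφ) fun x =>
    mul_le_mul_of_nonneg_right (gaussTail_antitone (h x)) (Real.exp_pos _).le

/-- Even convex functions whose epigraphs have Gaussian volume at least `δ` are uniformly bounded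
above on a fixed ball. -/
lemma exists_ball_conj_le {δ : ℝ} (hδ : 0 < δ) :
    ∃ r : ℝ, 0 < r ∧ ∃ C : ℝ, ∀ f : E → EReal, (∀ y, f (-y) = f y) → δ ≤ epiVolume (conj f) →
      ∀ x ∈ Metric.ball (0 : E) r, conj f x ≤ C := by
  set T := gaussTail ⊥ with hT
  have hTpos : 0 < T := (gaussTail_pos 0).trans_le (gaussTail_antitone bot_le)
  set W := ∫ x : E, Real.exp (-‖x‖ ^ 2 / 2)
  set W' := ∫ x : E, Real.exp (-‖x‖ ^ 2 / 4)
  obtain ⟨C, hC⟩ : ∃ C : ℝ, gaussTail C * W < δ / 3 := by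
    have := tendsto_gaussTail_atTop.mul_const W
    rw [zero_mul] at this
    exact (this.eventually (gt_mem_nhds (by positivity))).exists
  obtain ⟨R, hR0, hR⟩ : ∃ R : ℝ, 0 ≤ R ∧ T * Real.exp (-R ^ 2 / 4) * W' < δ / 3 := by
    have h1 : Tendsto (fun R : ℝ => -R ^ 2 / 4) atTop atBot := by
      simp only [neg_div]
      exact tendsto_neg_atTop_atBot.comp
        ((tendsto_pow_atTop two_ne_zero).atTop_div_const (by norm_num))
    have := ((Real.tendsto_exp_atBot.comp h1).const_mul T).mul_const W'
    rw [mul_zero, zero_mul] at this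
    exact ((eventually_ge_atTop 0).and
      (this.eventually (gt_mem_nhds (by positivity)))).exists
  obtain ⟨r, hr, hball⟩ := exists_ball_subset_of_symmetric_convex (E := E) (R := R)
    (δ := ENNReal.ofReal (δ / 3 / T)) (ENNReal.ofReal_pos.2 (by positivity))
  refine ⟨r, hr, C, fun f hf hV => ?_⟩
  have hKm : MeasurableSet {x | conj f x ≤ C} := measurableSet_le (measurable_conj f)
    measurable_const
  refine hball {x | conj f x ≤ C} hKm (convex_conj_le f C) (fun x hx => ?_) ?_
  · rwa [mem_ofPred_eq, conj_even hf]
  set A := {x | conj f x ≤ C} ∩ Metric.closedBall 0 R with hA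
  have hAm : MeasurableSet A := hKm.inter Metric.isClosed_closedBall.measurableSet
  have hAfin : volume A ≠ ⊤ :=
    ((measure_mono inter_subset_right).trans_lt measure_closedBall_lt_top).ne
  have hi1 := (integrable_exp_neg_norm_sq_div (E := E) (b := 2) two_pos).const_mul (gaussTail C)
  have hi2 : Integrable (A.indicator fun _ => T) :=
    (integrable_indicator_iff hAm).2 (integrableOn_const hAfin)
  have hi3 := (integrable_exp_neg_norm_sq_div (E := E) (b := 4) (by norm_num)).const_mul
    (T * Real.exp (-R ^ 2 / 4))
  have key : epiVolume (conj f) ≤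
      gaussTail C * W + volume.real A * T + T * Real.exp (-R ^ 2 / 4) * W' := by
    calc epiVolume (conj f) ≤ ∫ x : E, ((gaussTail C * Real.exp (-‖x‖ ^ 2 / 2) +
          A.indicator (fun _ => T) x) + T * Real.exp (-R ^ 2 / 4) * Real.exp (-‖x‖ ^ 2 / 4)) := by
          refine integral_mono (integrable_gaussTail_mul (measurable_conj f))
            ((hi1.add hi2).add hi3) fun x => ?_
          have e1 : 0 ≤ gaussTail C * Real.exp (-‖x‖ ^ 2 / 2) :=
            mul_nonneg (gaussTail_nonneg _) (Real.exp_pos _).le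
          have e2 : 0 ≤ A.indicator (fun _ => T) x := indicator_nonneg (fun _ _ => hTpos.le) _
          have e3 : 0 ≤ T * Real.exp (-R ^ 2 / 4) * Real.exp (-‖x‖ ^ 2 / 4) := by positivity
          have e4 := (le_abs_self _).trans (gaussTail_mul_le (conj f x) x)
          simp only
          by_cases hxC : conj f x ≤ C
          · by_cases hxR : ‖x‖ ≤ R
            · have : x ∈ A := ⟨hxC, by simpa using hxR⟩
              rw [indicator_of_mem this]
              have : Real.exp (-‖x‖ ^ 2 / 2) ≤ 1 := by
                rw [Real.exp_le_one_iff]; nlinarith [sq_nonneg ‖x‖]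
              nlinarith
            · have : Real.exp (-‖x‖ ^ 2 / 2) ≤
                  Real.exp (-R ^ 2 / 4) * Real.exp (-‖x‖ ^ 2 / 4) := by
                rw [← Real.exp_add, Real.exp_le_exp]
                nlinarith
              have := mul_le_mul_of_nonneg_left this hTpos.le
              linarith
          · have := mul_le_mul_of_nonneg_right (gaussTail_antitone (not_le.1 hxC).le)
              (Real.exp_pos (-‖x‖ ^ 2 / 2)).le
            linarith
      _ = _ := by
          have e5 := integral_add (hi1.add hi2) hi3
          have e6 := integral_add hi1 hi2
          simp only [Pi.add_apply] at e5
          rw [e5, e6, integral_const_mul,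
            integral_const_mul, integral_indicator_const _ hAm, smul_eq_mul]
  rw [← ENNReal.ofReal_toReal hAfin]
  refine ENNReal.ofReal_le_ofReal ?_
  rw [div_le_iff₀ hTpos]
  change _ ≤ volume.real A * T
  linarith

/-! ### Almost everywhere convergent subsequences of convex functions -/

/-- Convex functions that are uniformly bounded above on a ball have a subsequence which converges
almost everywhere in the extended reals. The subsequence is chosen to converge on a dense sequence
of points; divergence is then possible only on the frontiers of the convex sets
`{x | φ_k x ≤ t eventually}` with `t` rational, which are null sets. -/
lemma exists_subseq_ae_tendsto {f : ℕ → E → EReal} {r C : ℝ} (hr : 0 < r)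
    (hC : ∀ k, ∀ x ∈ Metric.ball (0 : E) r, conj (f k) x ≤ C) :
    ∃ σ : ℕ → ℕ, StrictMono σ ∧
      ∀ᵐ x : E, ∃ l, Tendsto (fun k => conj (f (σ k)) x) atTop (𝓝 l) := by
  obtain ⟨L, σ, hσ, hL⟩ := CompactSpace.tendsto_subseq
    fun (k : ℕ) (i : ℕ) => conj (f k) (TopologicalSpace.denseSeq E i)
  refine ⟨σ, hσ, ?_⟩
  rw [tendsto_pi_nhds] at hL
  let S : ℚ → Set E := fun q => {x | ∀ᶠ k in atTop, conj (f (σ k)) x ≤ ((q : ℝ) : EReal)}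
  have hS : ∀ q, Convex ℝ (S q) := by
    intro q x hx y hy a b ha hb hab
    filter_upwards [hx, hy] with k h1 h2
    exact convex_conj_le (f (σ k)) q h1 h2 ha hb hab
  have hnull : ∀ᵐ x : E, ∀ q, x ∉ frontier (S q) :=
    ae_all_iff.2 fun q => measure_eq_zero_iff_ae_notMem.1 ((hS q).addHaar_frontier volume)
  filter_upwards [hnull] with x hx
  refine ⟨limsup (fun k => conj (f (σ k)) x) atTop, tendsto_of_le_liminf_of_limsup_le ?_ le_rfl⟩
  by_contra hlt
  obtain ⟨q₂, h₁₂, h₂⟩ := EReal.lt_iff_exists_rat_btwn.1 (not_le.1 hlt)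
  obtain ⟨q₁, h₁, h₁₂⟩ := EReal.lt_iff_exists_rat_btwn.1 h₁₂
  have hq : (q₁ : ℝ) < q₂ := EReal.coe_lt_coe_iff.1 h₁₂
  have hfreq : ∃ᶠ k in atTop, conj (f (σ k)) x < ((q₁ : ℝ) : EReal) :=
    frequently_lt_of_liminf_lt (by isBoundedDefault) h₁
  refine hx q₂ ⟨?_, fun hxi => ?_⟩
  · rw [Metric.mem_closure_iff]
    intro η hη
    -- for small `ε` the ball of radius `ε r` about `(1 - ε) x` is close to `x`, and convexity
    -- bounds `φ_k` by `q₂` on it whenever `φ_k x ≤ q₁`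
    obtain ⟨ε, ⟨hε1, hε2, hε3⟩, hε0⟩ : ∃ ε : ℝ,
        (ε < 1 ∧ ε * (‖x‖ + r) < η ∧ (1 - ε) * q₁ + ε * C < q₂) ∧ 0 < ε := by
      have c1 : ∀ᶠ ε : ℝ in 𝓝 0, ε < 1 := gt_mem_nhds one_pos
      have c2 : ∀ᶠ ε : ℝ in 𝓝 0, ε * (‖x‖ + r) < η := by
        have : Continuous fun ε : ℝ => ε * (‖x‖ + r) := by fun_prop
        exact this.continuousAt.eventually (gt_mem_nhds (by simpa using hη))
      have c3 : ∀ᶠ ε : ℝ in 𝓝 0, (1 - ε) * q₁ + ε * C < q₂ := by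
        have : Continuous fun ε : ℝ => (1 - ε) * q₁ + ε * C := by fun_prop
        exact this.continuousAt.eventually (gt_mem_nhds (by simpa using hq))
      exact (((c1.and (c2.and c3)).filter_mono nhdsWithin_le_nhds).and
        (self_mem_nhdsWithin : ∀ᶠ ε : ℝ in 𝓝[>] 0, ε ∈ Ioi 0)).exists
    obtain ⟨i, hi⟩ := (TopologicalSpace.denseRange_denseSeq E).exists_mem_open
      (Metric.isOpen_ball (x := (1 - ε) • x) (ε := ε * r)) ⟨_, Metric.mem_ball_self (by positivity)⟩
    set d := TopologicalSpace.denseSeq E i with hd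
    have hw : ε⁻¹ • (d - (1 - ε) • x) ∈ Metric.ball (0 : E) r := by
      rw [mem_ball_zero_iff, norm_smul, norm_inv, Real.norm_of_nonneg hε0.le,
        inv_mul_lt_iff₀ hε0]
      rwa [Metric.mem_ball, dist_eq_norm] at hi
    have hdw : d = (1 - ε) • x + ε • (ε⁻¹ • (d - (1 - ε) • x)) := by
      rw [smul_smul, mul_inv_cancel₀ hε0.ne']; module
    refine ⟨d, ?_, ?_⟩
    · have hle : L i ≤ ((1 - ε) * q₁ + ε * C : ℝ) := by
        refine le_of_tendsto_of_frequently (hL i) (hfreq.mono fun k hk => ?_)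
        have := conj_convex hε0.le hε1.le hk.le (hC (σ k) _ hw)
        rwa [← hdw] at this
      have := (hL i).eventually (gt_mem_nhds (hle.trans_lt (EReal.coe_lt_coe_iff.2 hε3)))
      exact this.mono fun k hk => hk.le
    · rw [Metric.mem_ball, dist_eq_norm] at hi
      rw [dist_comm, dist_eq_norm]
      calc ‖d - x‖ = ‖(d - (1 - ε) • x) + (-ε) • x‖ := by congr 1; module
        _ ≤ ‖d - (1 - ε) • x‖ + ε * ‖x‖ := by
          refine (norm_add_le _ _).trans ?_
          rw [norm_smul, norm_neg, Real.norm_of_nonneg hε0.le]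
        _ < η := by nlinarith
  · have : limsup (fun k => conj (f (σ k)) x) atTop ≤ ((q₂ : ℝ) : EReal) :=
      limsup_le_of_le (by isBoundedDefault) (interior_subset hxi : x ∈ S q₂)
    exact absurd h₂ (not_lt.2 this)

end

/-! ### Existence of a maximiser -/

section

variable {E : Type*} [NormedAddCommGroup E] [InnerProductSpace ℝ E]
  [MeasurableSpace E] [BorelSpace E] [FiniteDimensional ℝ E]

lemma epiVolume_pos_iff {φ : E → EReal} (hφ : Measurable φ) :
    0 < epiVolume φ ↔ 0 < volume {x | φ x < ⊤} := by
  rw [epiVolume, integral_pos_iff_support_of_nonneg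
    (fun x => mul_nonneg (gaussTail_nonneg _) (Real.exp_pos _).le) (integrable_gaussTail_mul hφ)]
  suffices h : (Function.support fun x => gaussTail (φ x) * Real.exp (-‖x‖ ^ 2 / 2)) =
    {x | φ x < ⊤} by rw [h]
  ext x
  rw [Function.mem_support, mul_ne_zero_iff, and_iff_left (Real.exp_pos _).ne', mem_ofPred_eq,
    lt_top_iff_ne_top]
  refine ⟨fun h h' => h (by rw [h', gaussTail_top]), fun h => ?_⟩
  obtain ⟨r, hr, -⟩ := EReal.lt_iff_exists_real_btwn.1 (lt_top_iff_ne_top.2 h)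
  exact ((gaussTail_pos r).trans_le (gaussTail_antitone hr.le)).ne'

variable {μ : Measure E} [IsFiniteMeasure μ] [NeZero μ]

lemma Admissible.conj_nonneg (hmom : Integrable (fun x : E => ‖x‖) μ) {f : E → EReal}
    (hf : Admissible μ f) (x : E) : 0 ≤ conj f x := by
  refine ereal_le_of_forall_coe fun r hr => ?_
  have h1 := integral_abs_inner_le hmom hf hr
  have h2 : 0 ≤ ∫ y, |inner ℝ x y| ∂μ := integral_nonneg fun _ => abs_nonneg _
  have h3 : 0 ≤ r := nonneg_of_mul_nonneg_left (h2.trans h1) measureReal_univ_pos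
  exact_mod_cast h3

/-- The competitor is `‖y‖ - a`, where `a` is the mean of the norm; its conjugate is `a` on the unit
ball. -/
lemma exists_admissible_epiVolume_pos (hmom : Integrable (fun x : E => ‖x‖) μ) :
    ∃ f : E → EReal, Admissible μ f ∧ 0 < epiVolume (conj f) := by
  set a := (∫ y, ‖y‖ ∂μ) / μ.real univ
  refine ⟨fun y => ((‖y‖ - a : ℝ) : EReal), ⟨fun y => by rw [norm_neg], fun y => ‖y‖ - a,
    hmom.sub (integrable_const a), ?_, Eventually.of_forall fun _ => le_rfl⟩, ?_⟩
  · rw [integral_sub hmom (integrable_const a), integral_const, smul_eq_mul,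
      mul_div_cancel₀ _ measureReal_univ_pos.ne', sub_self]
  · rw [epiVolume_pos_iff (measurable_conj _)]
    refine (Metric.measure_ball_pos volume (0 : E) one_pos).trans_le
      (measure_mono fun x hx => ?_)
    refine lt_of_le_of_lt (conj_le_coe.2 fun y => ?_ : _ ≤ (a : EReal)) (EReal.coe_lt_top _)
    rw [EReal.coe_le_coe_iff]
    rw [mem_ball_zero_iff] at hx
    nlinarith [real_inner_le_norm x y, norm_nonneg y]

/-- If `φ = limsup conj (f k)` for admissible `f k` whose conjugates are bounded above at the
origin, then `conj φ` is admissible: by Fatou's lemma its majorant is the lower limit of the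
majorants of the `f k`. -/
lemma admissible_conj_limsup (hmom : Integrable (fun x : E => ‖x‖) μ) {f : ℕ → E → EReal}
    (hf : ∀ k, Admissible μ (f k)) {C : ℝ} (hC : ∀ k, conj (f k) 0 ≤ C) :
    Admissible μ (conj fun x => limsup (fun k => conj (f k) x) atTop) := by
  refine ⟨conj_even fun x => by simp only [conj_even (hf _).even], ?_⟩
  choose F hFi hF0 hfF using fun k => (hf k).majorant
  have hC0 : 0 ≤ C := by exact_mod_cast ((hf 0).conj_nonneg hmom 0).trans (hC 0)
  have hFC : ∀ᵐ y ∂μ, ∀ k, 0 ≤ F k y + C := by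
    refine ae_all_iff.2 fun k => ?_
    filter_upwards [hfF k] with y hy
    have := inner_le_of_conj_le (hC k) hy
    rw [inner_zero_left] at this
    linarith
  set G : ℕ → E → ENNReal := fun k y => ENNReal.ofReal (F k y + C)
  have hGm : ∀ k, AEMeasurable (G k) μ := fun k =>
    ((hFi k).aemeasurable.add_const C).ennreal_ofReal
  set g : E → ENNReal := fun y => liminf (fun k => G k y) atTop
  have hgm : AEMeasurable g μ := by
    refine ⟨fun y => liminf (fun k => (hGm k).mk (G k) y) atTop,
      Measurable.liminf fun k => (hGm k).measurable_mk, ?_⟩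
    filter_upwards [ae_all_iff.2 fun k => (hGm k).ae_eq_mk] with y hy
    simp only [g, hy]
  have hGint : ∀ k, ∫⁻ y, G k y ∂μ ≤ ENNReal.ofReal (C * μ.real univ) := by
    intro k
    have hi : Integrable (fun y => F k y + C) μ := (hFi k).add (integrable_const C)
    rw [← ofReal_integral_eq_lintegral_ofReal hi
      (hFC.mono fun y hy => hy k)]
    refine ENNReal.ofReal_le_ofReal ?_
    rw [integral_add (hFi k) (integrable_const C), integral_const, smul_eq_mul]
    linarith [hF0 k, mul_comm C (μ.real univ)]
  have hgint : ∫⁻ y, g y ∂μ ≤ ENNReal.ofReal (C * μ.real univ) :=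
    (lintegral_liminf_le' hGm).trans (liminf_le_of_le (by isBoundedDefault) fun b hb => by
      obtain ⟨k, hk⟩ := hb.exists
      exact hk.trans (hGint k))
  have hgt : ∫⁻ y, g y ∂μ ≠ ⊤ := (hgint.trans_lt ENNReal.ofReal_lt_top).ne
  have hgi : Integrable (fun y => (g y).toReal) μ := integrable_toReal_of_lintegral_ne_top hgm hgt
  have hglt : ∀ᵐ y ∂μ, g y < ⊤ := ae_lt_top' hgm hgt
  refine ⟨fun y => (g y).toReal - C, hgi.sub (integrable_const C), ?_, ?_⟩
  · rw [integral_sub hgi (integrable_const C), integral_toReal hgm hglt, integral_const,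
      smul_eq_mul]
    have := ENNReal.toReal_mono ENNReal.ofReal_ne_top hgint
    rw [ENNReal.toReal_ofReal (mul_nonneg hC0 measureReal_nonneg)] at this
    linarith [mul_comm C (μ.real univ)]
  · filter_upwards [hglt, ae_all_iff.2 hfF] with y hgy hfy
    refine conj_le_coe.2 fun x => ?_
    by_contra hlt
    obtain ⟨s, hs1, hs2⟩ := EReal.lt_iff_exists_real_btwn.1 (not_le.1 hlt)
    rw [EReal.coe_lt_coe_iff, real_inner_comm] at hs2
    have h1 : ENNReal.ofReal (inner ℝ x y - s + C) ≤ g y := by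
      refine le_liminf_of_le (by isBoundedDefault) ?_
      filter_upwards [eventually_lt_of_limsup_lt hs1] with k hk
      refine ENNReal.ofReal_le_ofReal ?_
      linarith [inner_le_of_conj_le hk.le (hfy k)]
    rw [ENNReal.ofReal_le_iff_le_toReal hgy.ne] at h1
    linarith

lemma exists_isMaxOn_epiVolume (hmom : Integrable (fun x : E => ‖x‖) μ) :
    ∃ f : E → EReal, Admissible μ f ∧ 0 < epiVolume (conj f) ∧
      ∀ g : E → EReal, Admissible μ g → epiVolume (conj g) ≤ epiVolume (conj f) := by
  set 𝒱 : Set ℝ := {v | ∃ f : E → EReal, Admissible μ f ∧ epiVolume (conj f) = v}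
  obtain ⟨f₀, hf₀, hpos⟩ := exists_admissible_epiVolume_pos hmom
  have hne : 𝒱.Nonempty := ⟨_, f₀, hf₀, rfl⟩
  have hbdd : BddAbove 𝒱 := by
    refine ⟨∫ x : E, gaussTail ⊥ * Real.exp (-‖x‖ ^ 2 / 2), ?_⟩
    rintro _ ⟨f, -, rfl⟩
    exact integral_mono (integrable_gaussTail_mul (measurable_conj f))
      ((integrable_exp_neg_norm_sq_div two_pos).const_mul _)
      fun x => (le_abs_self _).trans (gaussTail_mul_le _ x)
  have hS : 0 < sSup 𝒱 := hpos.trans_le (le_csSup hbdd ⟨f₀, hf₀, rfl⟩)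
  obtain ⟨u, -, hu, hu𝒱⟩ := exists_seq_tendsto_sSup hne hbdd
  obtain ⟨N, hN⟩ := eventually_atTop.1 (hu.eventually (lt_mem_nhds (half_lt_self hS)))
  choose f hf hfu using fun k => hu𝒱 (k + N)
  obtain ⟨r, hr, C, hC⟩ := exists_ball_conj_le (E := E) (half_pos hS)
  have hfC : ∀ k, ∀ x ∈ Metric.ball (0 : E) r, conj (f k) x ≤ C := fun k =>
    hC (f k) (hf k).even (by rw [hfu]; exact (hN _ (by omega)).le)
  obtain ⟨σ, hσ, hconv⟩ := exists_subseq_ae_tendsto hr hfC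
  set φ : E → EReal := fun x => limsup (fun k => conj (f (σ k)) x) atTop
  have hφm : Measurable φ := Measurable.limsup fun k => measurable_conj _
  have hlim : Tendsto (fun k => epiVolume (conj (f (σ k)))) atTop (𝓝 (epiVolume φ)) := by
    refine tendsto_integral_of_dominated_convergence
      (fun x => gaussTail ⊥ * Real.exp (-‖x‖ ^ 2 / 2))
      (fun k => (integrable_gaussTail_mul (measurable_conj _)).aestronglyMeasurable)
      ((integrable_exp_neg_norm_sq_div two_pos).const_mul _)
      (fun k => Eventually.of_forall fun x => gaussTail_mul_le _ x) ?_
    filter_upwards [hconv] with x ⟨l, hl⟩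
    have hφl : φ x = l := hl.limsup_eq
    have hl0 : 0 ≤ l := ge_of_tendsto' hl fun k => (hf _).conj_nonneg hmom x
    rw [hφl]
    exact ((continuousAt_gaussTail (fun h => by simp [h] at hl0)).tendsto.comp hl).mul_const _
  have hlim' : Tendsto (fun k => epiVolume (conj (f (σ k)))) atTop (𝓝 (sSup 𝒱)) := by
    simp only [hfu]
    exact hu.comp ((tendsto_add_atTop_nat N).comp hσ.tendsto_atTop)
  have hφS : epiVolume φ = sSup 𝒱 := tendsto_nhds_unique hlim hlim'
  have hge : sSup 𝒱 ≤ epiVolume (conj (conj φ)) :=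
    hφS.ge.trans (epiVolume_le_of_le (measurable_conj _) hφm (conj_conj_le φ))
  refine ⟨conj φ, admissible_conj_limsup hmom (fun k => hf (σ k))
    (fun k => hfC (σ k) 0 (Metric.mem_ball_self hr)), hS.trans_le hge, fun g hg => ?_⟩
  exact (le_csSup hbdd ⟨g, hg, rfl⟩).trans hge

end

/-! ### Differentiating the conjugate -/

section Differentiation

variable {E : Type*} [NormedAddCommGroup E] [InnerProductSpace ℝ E]

lemma convex_conj_lt_top (f : E → EReal) : Convex ℝ {x | conj f x < ⊤} := by
  intro x hx y hy a b ha hb hab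
  obtain rfl : a = 1 - b := by linarith
  obtain ⟨r, hr, -⟩ := EReal.lt_iff_exists_real_btwn.1 (mem_ofPred_eq ▸ hx)
  obtain ⟨s, hs, -⟩ := EReal.lt_iff_exists_real_btwn.1 (mem_ofPred_eq ▸ hy)
  exact (conj_convex hb (by linarith) hr.le hs.le).trans_lt (EReal.coe_lt_top _)

lemma coe_toReal_conj {f : E → EReal} (hf : ∃ y, f y ≠ ⊤) {x : E} (hx : conj f x < ⊤) :
    (((conj f x).toReal : ℝ) : EReal) = conj f x :=
  EReal.coe_toReal hx.ne (conj_ne_bot hf x)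

lemma convexOn_toReal_conj {f : E → EReal} (hf : ∃ y, f y ≠ ⊤) :
    ConvexOn ℝ {x | conj f x < ⊤} fun x => (conj f x).toReal := by
  refine ⟨convex_conj_lt_top f, fun x hx y hy a b ha hb hab => ?_⟩
  obtain rfl : a = 1 - b := by linarith
  have := conj_convex hb (by linarith) (coe_toReal_conj hf hx).ge (coe_toReal_conj hf hy).ge
  rw [← coe_toReal_conj hf (convex_conj_lt_top f hx hy ha hb hab), EReal.coe_le_coe_iff] at this
  exact this

lemma ae_differentiableAt_toReal_conj [MeasurableSpace E] [BorelSpace E] [FiniteDimensional ℝ E]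
    {f : E → EReal} (hf : ∃ y, f y ≠ ⊤) :
    ∀ᵐ x : E, x ∈ interior {x | conj f x < ⊤} →
      DifferentiableAt ℝ (fun x => (conj f x).toReal) x := by
  have hL := (convexOn_toReal_conj hf).locallyLipschitzOn_interior
  refine measure_null_of_locally_null _ fun x hx => ?_
  have hxi : x ∈ interior {x | conj f x < ⊤} := by
    by_contra h
    exact hx fun h' => absurd h' h
  obtain ⟨K, t, ht, hKt⟩ := hL hxi
  rw [isOpen_interior.nhdsWithin_eq hxi] at ht
  refine ⟨_, inter_mem self_mem_nhdsWithin
    (mem_nhdsWithin_of_mem_nhds (interior_mem_nhds.2 ht)), ?_⟩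
  refine measure_mono_null ?_ (ae_iff.1 (hKt.ae_differentiableWithinAt_of_mem (μ := volume)))
  rintro y ⟨hy, hyt⟩ hd
  exact hy fun _ => (hd (interior_subset hyt)).differentiableAt (mem_interior_iff_mem_nhds.1 hyt)

/-- At a point of differentiability, the near-maximisers `y` in `sup_y (⟪x, y⟫ - f y)` are close to
the gradient of the conjugate. -/
lemma exists_near_maximizers_close [CompleteSpace E] {f : E → EReal} (hf : ∃ y, f y ≠ ⊤) {x : E}
    (hx : x ∈ interior {x | conj f x < ⊤})
    (hd : DifferentiableAt ℝ (fun x => (conj f x).toReal) x) {η : ℝ} (hη : 0 < η) :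
    ∃ ε : ℝ, 0 < ε ∧ ∀ y, f y ≤ (inner ℝ x y - (conj f x).toReal + ε : ℝ) →
      ‖y - gradient (fun x => (conj f x).toReal) x‖ ≤ η := by
  set g : E → ℝ := fun x => (conj f x).toReal
  set y₀ := gradient g x
  have h1 := hasGradientAt_iff_isLittleO.1 hd.hasGradientAt
  have h2 := Asymptotics.isLittleO_iff.1 h1 (half_pos hη)
  obtain ⟨s, hs, hsub⟩ := Metric.eventually_nhds_iff_ball.1
    (h2.and (mem_interior_iff_mem_nhds.1 hx))
  refine ⟨η * (s / 2) / 2, by positivity, fun y hy => ?_⟩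
  rcases eq_or_ne (y - y₀) 0 with h0 | h0
  · rw [h0, norm_zero]; exact hη.le
  have hnpos : 0 < ‖y - y₀‖ := norm_pos_iff.2 h0
  -- test the affine minorant `⟪·, y⟫ - f y` of the conjugate at `x + v`
  set v : E := (s / 2 / ‖y - y₀‖) • (y - y₀) with hv
  have hvn : ‖v‖ = s / 2 := by
    rw [hv, norm_smul, Real.norm_of_nonneg (by positivity), div_mul_cancel₀ _ hnpos.ne']
  have hvi : inner ℝ v (y - y₀) = s / 2 * ‖y - y₀‖ := by
    rw [hv, real_inner_smul_left, real_inner_self_eq_norm_sq]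
    field_simp
  obtain ⟨h3, h4⟩ := hsub (x + v) (by rw [mem_ball_iff_norm, add_sub_cancel_left, hvn]; linarith)
  have h5 := inner_le_of_conj_le (coe_toReal_conj hf h4).ge hy
  rw [add_sub_cancel_left, hvn, Real.norm_eq_abs] at h3
  have h6 := (abs_le.1 h3).2
  rw [real_inner_comm] at h6
  rw [inner_add_left] at h5
  rw [inner_sub_right] at hvi
  change _ ≤ g (x + v) + _ at h5
  change _ + _ ≤ _ + (inner ℝ x y - g x + _) at h5
  have : s / 2 * ‖y - y₀‖ ≤ s / 2 * η := by
    rw [← hvi]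
    linarith
  exact le_of_mul_le_mul_left this (by positivity)

/-- Envelope formula: `d/dt (f + t k)* (x) = - k (∇ f* (x))` at `t = 0`. -/
lemma hasDerivAt_toReal_conj_add [CompleteSpace E] {f : E → EReal} (hf : ∃ y, f y ≠ ⊤) {x : E}
    (hx : x ∈ interior {x | conj f x < ⊤})
    (hd : DifferentiableAt ℝ (fun x => (conj f x).toReal) x) {k : E → ℝ} (hk : Continuous k)
    {B : ℝ} (hB : ∀ y, |k y| ≤ B) {p : ℝ → ℝ}
    (hp : ∀ t, (p t : EReal) = conj (fun y => f y + (t * k y : ℝ)) x) :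
    HasDerivAt p (-k (gradient (fun x => (conj f x).toReal) x)) 0 := by
  set y₀ := gradient (fun x => (conj f x).toReal) x
  have hp0 : (p 0 : EReal) = conj f x := by simp [hp]
  have hp0' : (conj f x).toReal = p 0 := by rw [← hp0, EReal.toReal_coe]
  have hB0 : 0 ≤ B := (abs_nonneg _).trans (hB 0)
  rw [hasDerivAt_iff_isLittleO, Asymptotics.isLittleO_iff]
  intro η hη
  obtain ⟨η', hη', hkη⟩ := Metric.continuous_iff.1 hk y₀ η hη
  obtain ⟨ε, hε, hclose⟩ := exists_near_maximizers_close hf hx hd (half_pos hη')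
  rw [hp0'] at hclose
  have hnear : ∀ y, f y ≤ (inner ℝ x y - p 0 + ε : ℝ) → |k y - k y₀| ≤ η := fun y hy => by
    have := hkη y (by rw [dist_eq_norm]; linarith [hclose y hy])
    exact this.le
  filter_upwards [Metric.ball_mem_nhds (0 : ℝ) (show 0 < ε / (2 * B + 1) by positivity)] with t ht
  rw [mem_ball_zero_iff, Real.norm_eq_abs, lt_div_iff₀ (by positivity)] at ht
  rw [sub_zero, smul_eq_mul, Real.norm_eq_abs, Real.norm_eq_abs, abs_le]
  have habs : ∀ y, |k y - k y₀| ≤ η → |t * (k y - k y₀)| ≤ η * |t| := fun y hy => by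
    rw [abs_mul, mul_comm]
    exact mul_le_mul_of_nonneg_right hy (abs_nonneg _)
  constructor
  · have : ∀ ε' : ℝ, 0 < ε' → p 0 - t * k y₀ - η * |t| ≤ p t + ε' := by
      intro ε' hε'
      obtain ⟨y, hy⟩ : ∃ y, f y < (inner ℝ x y - (p 0 - min ε' ε) : ℝ) := by
        by_contra! h
        have := conj_le_coe.2 h
        rw [← hp0, EReal.coe_le_coe_iff] at this
        linarith [lt_min hε' hε]
      have h1 := habs y (hnear y (hy.le.trans (EReal.coe_le_coe_iff.2 (by
        linarith [min_le_right ε' ε]))))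
      have h2 : f y + (t * k y : ℝ) ≤ (inner ℝ x y - (p 0 - min ε' ε) + t * k y : ℝ) := by
        rw [EReal.coe_add]
        gcongr
      have h3 := inner_le_of_conj_le (f := fun y => f y + (t * k y : ℝ)) (hp t).ge h2
      have h4 := (abs_le.1 h1).2
      linarith [min_le_left ε' ε]
    linarith [le_of_forall_pos_le_add this]
  · have : conj (fun y => f y + (t * k y : ℝ)) x ≤ (p 0 - t * k y₀ + η * |t| : ℝ) := by
      refine conj_le_coe.2 fun y => coe_le_add_coe_iff.2 ?_
      by_cases hy : f y ≤ (inner ℝ x y - p 0 + ε : ℝ)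
      · have h1 := (abs_le.1 (habs y (hnear y hy))).1
        refine le_trans (EReal.coe_le_coe_iff.2 ?_) (conj_le_coe.1 hp0.ge y)
        linarith
      · refine le_trans (EReal.coe_le_coe_iff.2 ?_) (not_le.1 hy).le
        have h1 : |t * (k y - k y₀)| ≤ |t| * (2 * B) := by
          rw [abs_mul]
          refine mul_le_mul_of_nonneg_left ?_ (abs_nonneg _)
          linarith [abs_sub (k y) (k y₀), hB y, hB y₀]
        have h2 := (abs_le.1 h1).1
        nlinarith [abs_nonneg t, mul_nonneg hη.le (abs_nonneg t)]
    rw [← hp, EReal.coe_le_coe_iff] at this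
    linarith

end Differentiation

/-! ### The Euler–Lagrange equation -/

section EulerLagrange

variable {E : Type*} [NormedAddCommGroup E] [InnerProductSpace ℝ E]
  [MeasurableSpace E] [BorelSpace E] [FiniteDimensional ℝ E]

lemma measurable_gradient (g : E → ℝ) : Measurable (gradient g) :=
  (InnerProductSpace.toDual ℝ E).symm.continuous.measurable.comp (measurable_fderiv ℝ g)

lemma Admissible.add_mul {E : Type*} [NormedAddCommGroup E] [MeasurableSpace E] {μ : Measure E}
    {f : E → EReal} (hf : Admissible μ f) {k : E → ℝ}
    (hki : Integrable k μ) (hke : ∀ y, k (-y) = k y) (hk0 : ∫ y, k y ∂μ = 0) (t : ℝ) :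
    Admissible μ fun y => f y + (t * k y : ℝ) := by
  refine ⟨fun y => by simp only [hf.even, hke], ?_⟩
  obtain ⟨F, hF, hF0, hfF⟩ := hf.majorant
  refine ⟨fun y => F y + t * k y, hF.add (hki.const_mul t), ?_, ?_⟩
  · rw [integral_add hF (hki.const_mul t), integral_const_mul, hk0, mul_zero, add_zero]
    exact hF0
  · filter_upwards [hfF] with y hy
    rw [EReal.coe_add]
    gcongr

lemma conj_add_mul_le {E : Type*} [NormedAddCommGroup E] [InnerProductSpace ℝ E]
    {f : E → EReal} {k : E → ℝ} {B : ℝ} (hB : ∀ y, |k y| ≤ B) (s t : ℝ) {x : E}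
    {r : ℝ} (h : conj (fun y => f y + (s * k y : ℝ)) x ≤ r) :
    conj (fun y => f y + (t * k y : ℝ)) x ≤ (r + |s - t| * B : ℝ) := by
  refine conj_add_le (k := fun y => s * k y) (fun y => ?_) h
  have h1 : (s - t) * k y ≤ |s - t| * B :=
    (le_abs_self _).trans ((abs_mul _ _).le.trans
      (mul_le_mul_of_nonneg_left (hB y) (abs_nonneg _)))
  linarith

lemma abs_gaussTail_conj_sub_le {E : Type*} [NormedAddCommGroup E] [InnerProductSpace ℝ E]
    {f : E → EReal} (hf : ∃ y, f y ≠ ⊤) {k : E → ℝ} {B : ℝ}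
    (hB : ∀ y, |k y| ≤ B) (s t : ℝ) (x : E) :
    |gaussTail (conj (fun y => f y + (s * k y : ℝ)) x) -
      gaussTail (conj (fun y => f y + (t * k y : ℝ)) x)| ≤ |s - t| * B := by
  have hB0 : 0 ≤ B := (abs_nonneg _).trans (hB 0)
  have hft : ∀ t : ℝ, ∃ y, f y + (t * k y : ℝ) ≠ ⊤ := fun t => by
    obtain ⟨y, hy⟩ := hf
    exact ⟨y, EReal.add_ne_top hy (EReal.coe_ne_top _)⟩
  by_cases hs : conj (fun y => f y + (s * k y : ℝ)) x < ⊤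
  · have hs' := coe_toReal_conj (hft s) hs
    have h1 := conj_add_mul_le hB s t hs'.ge
    have ht' := coe_toReal_conj (hft t) (h1.trans_lt (EReal.coe_lt_top _))
    have h2 := conj_add_mul_le hB t s ht'.ge
    rw [← ht', EReal.coe_le_coe_iff] at h1
    rw [← hs', EReal.coe_le_coe_iff, abs_sub_comm t s] at h2
    rw [← hs', ← ht']
    refine (abs_gaussTail_sub_le _ _).trans (abs_le.2 ⟨?_, ?_⟩) <;> linarith
  · have ht : ¬ conj (fun y => f y + (t * k y : ℝ)) x < ⊤ := fun ht => hs
      ((conj_add_mul_le hB t s (coe_toReal_conj (hft t) ht).ge).trans_lt (EReal.coe_lt_top _))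
    rw [not_lt_top_iff.1 hs, not_lt_top_iff.1 ht, sub_self, abs_zero]
    positivity

/-- The first variation of the Gaussian volume at a maximiser vanishes. -/
lemma integral_firstVariation_eq_zero {μ : Measure E} [IsFiniteMeasure μ] [NeZero μ]
    {f : E → EReal} (hf : Admissible μ f)
    (hmax : ∀ g : E → EReal, Admissible μ g → epiVolume (conj g) ≤ epiVolume (conj f))
    {k : E → ℝ} (hk : Continuous k) {B : ℝ} (hB : ∀ y, |k y| ≤ B) (hke : ∀ y, k (-y) = k y)
    (hk0 : ∫ y, k y ∂μ = 0) :
    ∫ x, {x | conj f x < ⊤}.indicator (fun x => Real.exp (-(conj f x).toReal ^ 2 / 2) *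
      Real.exp (-‖x‖ ^ 2 / 2) * k (gradient (fun x => (conj f x).toReal) x)) x = 0 := by
  have hft := hf.exists_ne_top
  have hki : Integrable k μ := (integrable_const B).mono' hk.aestronglyMeasurable
    (Eventually.of_forall hB)
  have hB0 : 0 ≤ B := (abs_nonneg _).trans (hB 0)
  have h0 : (fun y => f y + ((0 * k y : ℝ) : EReal)) = f := by simp
  have hdomm : MeasurableSet {x | conj f x < ⊤} :=
    measurableSet_lt (measurable_conj f) measurable_const
  have hder := (hasDerivAt_integral_of_dominated_loc_of_lip (μ := (volume : Measure E))
    (F := fun t x => gaussTail (conj (fun y => f y + (t * k y : ℝ)) x) *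
      Real.exp (-‖x‖ ^ 2 / 2))
    (F' := {x | conj f x < ⊤}.indicator (fun x => Real.exp (-(conj f x).toReal ^ 2 / 2) *
      Real.exp (-‖x‖ ^ 2 / 2) * k (gradient (fun x => (conj f x).toReal) x)))
    (x₀ := 0) (s := univ) (bound := fun x => B * Real.exp (-‖x‖ ^ 2 / 2)) univ_mem
    (Eventually.of_forall fun t =>
      (integrable_gaussTail_mul (measurable_conj _)).aestronglyMeasurable)
    (integrable_gaussTail_mul (measurable_conj _)) ?_ ?_
    ((integrable_exp_neg_norm_sq_div two_pos).const_mul B) ?_).2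
  · refine IsLocalMax.hasDerivAt_eq_zero ?_ hder
    refine Eventually.of_forall fun t => ?_
    have := hmax _ (hf.add_mul hki hke hk0 t)
    simp only [h0]
    exact this
  · refine (Measurable.indicator ?_ hdomm).aestronglyMeasurable
    have h1 : Measurable fun x => (conj f x).toReal := (measurable_conj f).ereal_toReal
    have h2 := hk.measurable.comp (measurable_gradient fun x => (conj f x).toReal)
    exact (((h1.pow_const 2).neg.div_const 2).exp.mul (by fun_prop)).mul h2
  · refine Eventually.of_forall fun x => LipschitzOnWith.of_dist_le_mul fun s _ t _ => ?_
    rw [Real.dist_eq, Real.dist_eq, ← sub_mul, abs_mul, abs_of_pos (Real.exp_pos _),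
      Real.coe_nnabs, abs_of_nonneg (mul_nonneg hB0 (Real.exp_pos _).le)]
    have := mul_le_mul_of_nonneg_right (abs_gaussTail_conj_sub_le hft hB s t x)
      (Real.exp_pos (-‖x‖ ^ 2 / 2)).le
    linarith
  · have hfr : ∀ᵐ x : E, x ∉ frontier {x | conj f x < ⊤} :=
      measure_eq_zero_iff_ae_notMem.1 ((convex_conj_lt_top f).addHaar_frontier volume)
    filter_upwards [hfr, ae_differentiableAt_toReal_conj hft] with x hx hd
    by_cases hxt : x ∈ {x | conj f x < ⊤}
    · rw [indicator_of_mem hxt]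
      have hxi : x ∈ interior {x | conj f x < ⊤} := by
        by_contra h
        exact hx ⟨subset_closure hxt, h⟩
      have hp : ∀ t : ℝ, (((conj (fun y => f y + (t * k y : ℝ)) x).toReal : ℝ) : EReal) =
          conj (fun y => f y + (t * k y : ℝ)) x := fun t => by
        have h1 : conj (fun y => f y + ((0 * k y : ℝ) : EReal)) x ≤ (conj f x).toReal := by
          rw [h0]; exact (coe_toReal_conj hft hxt).ge
        refine coe_toReal_conj ?_ ((conj_add_mul_le hB 0 t h1).trans_lt (EReal.coe_lt_top _))
        obtain ⟨y, hy⟩ := hft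
        exact ⟨y, EReal.add_ne_top hy (EReal.coe_ne_top _)⟩
      have h1 := hasDerivAt_toReal_conj_add hft hxi (hd hxi) hk hB hp
      have h2 := ((hasDerivAt_gaussTail _).comp 0 h1).mul_const (Real.exp (-‖x‖ ^ 2 / 2))
      simp only [h0, Function.comp_def, hp] at h2
      exact h2.congr_deriv (by ring)
    · rw [indicator_of_notMem hxt]
      -- the perturbed conjugates are `⊤` at `x` as well
      have h1 : ∀ t : ℝ, conj (fun y => f y + (t * k y : ℝ)) x = ⊤ := fun t => by
        by_contra h
        have h2 := conj_add_mul_le hB t 0 (coe_toReal_conj (by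
          obtain ⟨y, hy⟩ := hft
          exact ⟨y, EReal.add_ne_top hy (EReal.coe_ne_top _)⟩) (lt_top_iff_ne_top.2 h)).ge
        rw [h0] at h2
        exact hxt (h2.trans_lt (EReal.coe_lt_top _))
      simp only [h1]
      exact hasDerivAt_const _ _

lemma gradient_neg_of_even {E : Type*} [NormedAddCommGroup E] [InnerProductSpace ℝ E]
    [CompleteSpace E] {g : E → ℝ} (hg : ∀ x, g (-x) = g x) (x : E) :
    gradient g (-x) = -gradient g x := by
  have h := (ContinuousLinearEquiv.neg ℝ : E ≃L[ℝ] E).comp_right_fderiv (f := g) (x := x)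
  have h1 : g ∘ (ContinuousLinearEquiv.neg ℝ : E ≃L[ℝ] E) = g := funext hg
  rw [h1] at h
  have h2 : fderiv ℝ g x = -fderiv ℝ g (-x) := by
    rw [h]
    ext v
    simp
  simp only [gradient, h2, map_neg, neg_neg]

end EulerLagrange

/-! ### Gaussian moment measures -/

variable {n : ℕ}

lemma measurable_momentDensity {φ : EuclideanSpace ℝ (Fin n) → EReal} (hφ : Measurable φ) :
    Measurable (momentDensity φ) := by
  refine Measurable.indicator (Measurable.ennreal_ofReal ?_) (measurableSet_lt hφ measurable_const)
  exact (measurable_const.mul ((hφ.ereal_toReal.pow_const 2).neg.div_const 2).exp).mul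
    (by fun_prop)

lemma momentDensity_lt_top (φ : EuclideanSpace ℝ (Fin n) → EReal) (x) :
    momentDensity φ x < ⊤ := by
  unfold momentDensity
  by_cases h : x ∈ {x | φ x < ⊤}
  · rw [indicator_of_mem h]; exact ENNReal.ofReal_lt_top
  · rw [indicator_of_notMem h]; exact ENNReal.zero_lt_top

lemma integral_gaussianMomentMeasure {φ : EuclideanSpace ℝ (Fin n) → EReal} (hφ : Measurable φ)
    {h : EuclideanSpace ℝ (Fin n) → ℝ} (hh : Continuous h) :
    ∫ y, h y ∂(gaussianMomentMeasure φ) = (2 * Real.pi) ^ (-((n : ℝ) + 1) / 2) *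
      ∫ x, {x | φ x < ⊤}.indicator (fun x => Real.exp (-(φ x).toReal ^ 2 / 2) *
        Real.exp (-‖x‖ ^ 2 / 2) * h (gradient (fun x => (φ x).toReal) x)) x := by
  rw [gaussianMomentMeasure, integral_map (measurable_gradient _).aemeasurable
    hh.aestronglyMeasurable, integral_withDensity_eq_integral_toReal_smul
    (measurable_momentDensity hφ) (Eventually.of_forall (momentDensity_lt_top φ)),
    ← integral_const_mul]
  refine integral_congr_ae (Eventually.of_forall fun x => ?_)
  simp only [momentDensity]
  by_cases hx : x ∈ {x | φ x < ⊤}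
  · rw [indicator_of_mem hx, indicator_of_mem hx, ENNReal.toReal_ofReal (by positivity),
      smul_eq_mul]
    ring
  · rw [indicator_of_notMem hx, indicator_of_notMem hx]
    simp

lemma gaussianMomentMeasure_univ (φ : EuclideanSpace ℝ (Fin n) → EReal) :
    gaussianMomentMeasure φ univ = ∫⁻ x, momentDensity φ x := by
  rw [gaussianMomentMeasure, Measure.map_apply (measurable_gradient _) MeasurableSet.univ,
    preimage_univ, withDensity_apply _ MeasurableSet.univ, setLIntegral_univ]

lemma gaussianMomentMeasure_univ_lt_top (φ : EuclideanSpace ℝ (Fin n) → EReal) :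
    gaussianMomentMeasure φ univ < ⊤ := by
  rw [gaussianMomentMeasure_univ]
  refine lt_of_le_of_lt (lintegral_mono fun x => ?_)
    ((integrable_exp_neg_norm_sq_div (E := EuclideanSpace ℝ (Fin n)) two_pos).const_mul
      ((2 * Real.pi) ^ (-((n : ℝ) + 1) / 2))).lintegral_lt_top
  refine (indicator_le_self _ _ _).trans (ENNReal.ofReal_le_ofReal ?_)
  gcongr
  refine mul_le_of_le_one_right (by positivity) ?_
  rw [Real.exp_le_one_iff]
  nlinarith [sq_nonneg (φ x).toReal]

lemma gaussianMomentMeasure_univ_pos {φ : EuclideanSpace ℝ (Fin n) → EReal} (hφ : Measurable φ)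
    (h : 0 < volume {x | φ x < ⊤}) : 0 < gaussianMomentMeasure φ univ := by
  rw [gaussianMomentMeasure_univ, lintegral_pos_iff_support (measurable_momentDensity hφ)]
  refine h.trans_le (measure_mono fun x hx => ?_)
  rw [Function.mem_support, momentDensity, indicator_of_mem hx]
  exact (ENNReal.ofReal_pos.2 (by positivity)).ne'

lemma integral_gaussianMomentMeasure_comp_neg {φ : EuclideanSpace ℝ (Fin n) → EReal}
    (hφ : Measurable φ) (heven : ∀ x, φ (-x) = φ x) {h : EuclideanSpace ℝ (Fin n) → ℝ}
    (hh : Continuous h) :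
    ∫ y, h (-y) ∂(gaussianMomentMeasure φ) = ∫ y, h y ∂(gaussianMomentMeasure φ) := by
  rw [integral_gaussianMomentMeasure hφ (h := fun y => h (-y)) (by fun_prop),
    integral_gaussianMomentMeasure hφ hh]
  congr 1
  rw [← integral_neg_eq_self]
  refine integral_congr_ae (Eventually.of_forall fun x => ?_)
  simp only [indicator, mem_ofPred_eq, heven, norm_neg,
    gradient_neg_of_even (g := fun x => (φ x).toReal) (fun x => by rw [heven]), neg_neg]

lemma memL_conj {f : EuclideanSpace ℝ (Fin n) → EReal} (hf : ∃ y, f y ≠ ⊤)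
    (hp : ∃ x, conj f x < ⊤) {c : ℝ} (hc : 0 < c)
    (h : ∀ x, ((c * ‖x‖ : ℝ) : EReal) ≤ conj f x) : MemL (conj f) where
  toIsConvFun := isConvFun_conj hf hp
  growth := by
    refine (EReal.coe_pos.2 hc).trans_le (le_liminf_of_le (by isBoundedDefault) ?_)
    filter_upwards [Bornology.isBounded_def.1
      (Bornology.isBounded_singleton (x := (0 : EuclideanSpace ℝ (Fin n))))] with x hx
    have hx0 : 0 < ‖x‖ := norm_pos_iff.2 hx
    rw [EReal.le_div_iff_mul_le (EReal.coe_pos.2 hx0) (EReal.coe_ne_top _), ← EReal.coe_mul]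
    exact h x

end GaussianMinkowski

end

theorem theorem4p6 (n : ℕ) (hn : 1 ≤ n)
    (μ : Measure (EuclideanSpace ℝ (Fin n))) (hfin : IsFiniteMeasure μ) (hμ : μ ≠ 0)
    (heven : μ.IsNegInvariant)
    (hconc : ∀ H : Submodule ℝ (EuclideanSpace ℝ (Fin n)), Module.finrank ℝ H < n →
      μ ((H : Set (EuclideanSpace ℝ (Fin n)))ᶜ) ≠ 0)
    (hmom : Integrable (fun x : EuclideanSpace ℝ (Fin n) => ‖x‖) μ) :
    ∃ φ : EuclideanSpace ℝ (Fin n) → EReal, GaussianMinkowski.MemL φ ∧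
      0 < GaussianMinkowski.gaussianMomentMeasure φ univ ∧
      GaussianMinkowski.gaussianMomentMeasure φ univ < ⊤ ∧
      μ = (μ univ / GaussianMinkowski.gaussianMomentMeasure φ univ) •
        GaussianMinkowski.gaussianMomentMeasure φ := by
  open GaussianMinkowski in
  have : NeZero μ := ⟨hμ⟩
  obtain ⟨f, hf, hpos, hmax⟩ := exists_isMaxOn_epiVolume hmom
  obtain ⟨c, hc, hcN⟩ := exists_mul_norm_le_integral_abs_inner hmom
    (by simpa only [finrank_euclideanSpace_fin] using hconc)
  have hM : 0 < μ.real univ := measureReal_univ_pos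
  have hvol : 0 < volume {x | conj f x < ⊤} := (epiVolume_pos_iff (measurable_conj f)).1 hpos
  have hm := measurable_conj f
  set ν := gaussianMomentMeasure (conj f) with hν
  have hν0 : 0 < ν univ := gaussianMomentMeasure_univ_pos hm hvol
  have hνt : ν univ < ⊤ := gaussianMomentMeasure_univ_lt_top _
  have : IsFiniteMeasure ν := ⟨hνt⟩
  have hνr : 0 < ν.real univ := ENNReal.toReal_pos hν0.ne' hνt.ne
  refine ⟨conj f, memL_conj hf.exists_ne_top (nonempty_of_measure_ne_zero hvol.ne')
    (div_pos hc hM) fun x => ?_, hν0, hνt, ?_⟩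
  · refine ereal_le_of_forall_coe fun r hr => EReal.coe_le_coe_iff.2 ?_
    rw [div_mul_eq_mul_div, div_le_iff₀ hM]
    exact (hcN x).trans (integral_abs_inner_le hmom hf hr)
  have hct : μ univ / ν univ ≠ ⊤ := (ENNReal.div_lt_top (measure_ne_top μ _) hν0.ne').ne
  have : IsFiniteMeasure ((μ univ / ν univ) • ν) := ν.smul_finite hct
  refine ext_of_forall_integral_eq_of_IsFiniteMeasure fun h => ?_
  have hhc : Continuous h := h.continuous
  have hi : ∀ ρ : Measure (EuclideanSpace ℝ (Fin n)), IsFiniteMeasure ρ →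
      Integrable h ρ ∧ Integrable (fun y => h (-y)) ρ := fun ρ _ =>
    ⟨(integrable_const ‖h‖).mono' hhc.aestronglyMeasurable
      (Eventually.of_forall h.norm_coe_le_norm),
      (integrable_const ‖h‖).mono' (hhc.comp continuous_neg).aestronglyMeasurable
      (Eventually.of_forall fun y => h.norm_coe_le_norm (-y))⟩
  -- the even part of `h`, normalised to have mean zero, is an admissible direction
  set a := (∫ y, h y ∂μ) / μ.real univ with ha
  set k : EuclideanSpace ℝ (Fin n) → ℝ := fun y => (h y + h (-y)) / 2 - a with hk
  have hint : ∀ ρ : Measure (EuclideanSpace ℝ (Fin n)), IsFiniteMeasure ρ →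
      (∫ y, h (-y) ∂ρ = ∫ y, h y ∂ρ) → ∫ y, k y ∂ρ = ∫ y, h y ∂ρ - a * ρ.real univ := by
    intro ρ hρ hsymm
    have h1 := (hi ρ hρ).1
    have h2 := (hi ρ hρ).2
    have h3 : Integrable (fun y => (h y + h (-y)) / 2) ρ := (h1.add h2).div_const 2
    rw [hk, integral_sub h3 (integrable_const a), integral_div, integral_add h1 h2, hsymm,
      integral_const, smul_eq_mul]
    ring
  have hkc : Continuous k := by fun_prop
  have hk0 : ∫ y, k y ∂μ = 0 := by
    rw [hint μ hfin (integral_neg_eq_self _ μ), ha, div_mul_cancel₀ _ hM.ne', sub_self]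
  have hkB : ∀ y, |k y| ≤ ‖h‖ + |a| := fun y => by
    have h1 := abs_le.1 (h.norm_coe_le_norm y)
    have h2 := abs_le.1 (h.norm_coe_le_norm (-y))
    have h3 := neg_abs_le a
    have h4 := le_abs_self a
    rw [abs_le]
    constructor <;> simp only [hk] <;> linarith
  have hkν : ∫ y, k y ∂ν = 0 := by
    rw [hν, integral_gaussianMomentMeasure hm hkc, integral_firstVariation_eq_zero hf hmax hkc hkB
      (fun y => by simp only [hk, neg_neg, add_comm]) hk0, mul_zero]
  rw [hint ν ‹_› (integral_gaussianMomentMeasure_comp_neg hm (conj_even hf.even) hhc),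
    sub_eq_zero] at hkν
  rw [integral_smul_measure, hkν, ENNReal.toReal_div, smul_eq_mul, ha]
  change _ = μ.real univ / ν.real univ * _
  field_simp
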